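/- Let $\mathbb S^2\subset\mathbb R^3$ be the unit sphere, with surface area measure and total area $|\mathbb S^2|=4\pi$. A sampling of size $n$ consists of points $x_1,\dots,x_n\in\mathbb S^2$ together with measurable patches $\sigma_1,\dots,\sigma_n\subset\mathbb S^2$ that tile the sphere up to sets of area zero; it is equi-area if all $\sigma_i$ have the same area. Put $d_i=\sup_{p\in\sigma_i}\|x_i-p\|$ and $d^{(n)}=\max_i d_i$. For $t>0$, $f:\mathbb S^2\to\mathbb R$ and $y\in\mathbb S^2$ let $$L_n^tf(y)=\frac1n\sum_{i=1}^n e^{-\|x_i-y\|^2/(4t)}\,\bigl(f(y)-f(x_i)\bigr),\qquad \hat L_n^tf(y)=\frac{|\mathbb S^2|}{4\pi t^2}\,L_n^tf(y).$$ Let $\Delta_{\mathbb S^2}f=-\operatorname{div}(\nabla_{\mathbb S^2}f)$ be the (nonnegative) Laplace–Beltrami operator. Theorem. Consider a sequence of equi-area samplings of the sphere whose sizes $n$ tend to infinity (for instance one for each $n\ge1$), such that $d^{(n)}\le C/n^{\alpha}$ for constants $C\in\mathbb R$ and $\alpha\in(0,1/2]$ that do not depend on $n$. Let $f:\mathbb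 S^2\to\mathbb R$ be Lipschitz with respect to the Euclidean distance of $\mathbb R^3$, and let $y\in\mathbb S^2$ be a point at which $\Delta_{\mathbb S^2}f$ is defined, that is, $f$ is differentiable in a neighbourhood of $y$ and $\nabla_{\mathbb S^2}f$ is differentiable at $y$ (if $f$ is smooth, every $y\in\mathbb S^2$ qualifies). Then there is a sequence $t_n=n^\beta$, $\beta\in\mathbb R$, such that $$\lim_{n\to\infty}\hat L_n^{t_n}f(y)=\Delta_{\mathbb S^2}f(y),$$ and indeed this holds for every $\beta\in(-2\alpha/5,\,0)$. -/

import Mathlib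

open Filter Topology MeasureTheory
open scoped NNReal

noncomputable section

namespace SphereSampling

/-- Euclidean space `ℝ³`. -/
abbrev E3 : Type := EuclideanSpace ℝ (Fin 3)

/-- The unit sphere `𝕊²` of `ℝ³`; its distance is the Euclidean distance of `ℝ³`. -/
abbrev S2 : Type := Metric.sphere (0 : E3) 1

/-- The surface area measure of `𝕊²` (of total mass `4π`). -/
def area : Measure S2 := (volume : Measure E3).toSphere

/-- The total area `|𝕊²|`. -/
def totalArea : ℝ := area.real Set.univ

/-! ### Samplings -/

/-- A sampling of the sphere with `n` points `x i`, and with a patch `σ i` of the sphere for each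
of them. The patches are measurable and tile the sphere; they may overlap in sets of area zero
(such as common boundary arcs) and leave out a set of area zero. -/
structure Sampling (n : ℕ) where
  /-- the sampling points -/
  x : Fin n → S2
  /-- the patches -/
  σ : Fin n → Set S2
  measurableSet_patch : ∀ i, MeasurableSet (σ i)
  aedisjoint_patch : ∀ i j, i ≠ j → area (σ i ∩ σ j) = 0
  cover : area (⋃ i, σ i)ᶜ = 0

/-- The area `A_i` of the `i`-th patch. -/
def Sampling.A {n : ℕ} (V : Sampling n) (i : Fin n) : ℝ := area.real (V.σ i)

/-- The sampling is equi-area: all patches have the same area. -/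
def Sampling.IsEquiArea {n : ℕ} (V : Sampling n) : Prop := ∀ i j, V.A i = V.A j

/-- The radius `d_i` of the `i`-th patch: the largest Euclidean distance between the point `x i`
and a point of its patch. -/
def Sampling.d {n : ℕ} (V : Sampling n) (i : Fin n) : ℝ :=
  sSup ((fun p : S2 => ‖(V.x i : E3) - (p : E3)‖) '' V.σ i)

/-- The maximal patch radius `max_i d_i`. -/
def Sampling.maxRadius {n : ℕ} (V : Sampling n) : ℝ := ⨆ i, V.d i

/-! ### Extended graph Laplacian -/

/-- The extended graph Laplacian
`L_n^t f (y) = (1/n) ∑_i exp(-‖x_i - y‖² / (4t)) (f(y) - f(x_i))`. -/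
def Sampling.L {n : ℕ} (V : Sampling n) (t : ℝ) (f : S2 → ℝ) (y : S2) : ℝ :=
  (1 / (n : ℝ)) *
    ∑ i, Real.exp (-(‖(V.x i : E3) - (y : E3)‖ ^ 2 / (4 * t))) * (f y - f (V.x i))

/-- The rescaled extended graph Laplacian `|𝕊²| (4πt²)⁻¹ L_n^t`. -/
def Sampling.Lhat {n : ℕ} (V : Sampling n) (t : ℝ) (f : S2 → ℝ) (y : S2) : ℝ :=
  totalArea * (4 * Real.pi * t ^ 2)⁻¹ * V.L t f y

/-! ### The Laplace-Beltrami operator -/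

/-- The radial projection `x ↦ x / ‖x‖` of `ℝ³ ∖ {0}` onto the sphere. -/
def radialProj (x : E3) (hx : x ≠ 0) : S2 :=
  ⟨‖x‖⁻¹ • x, by
    rw [mem_sphere_zero_iff_norm, norm_smul, norm_inv, norm_norm,
      inv_mul_cancel₀ (norm_ne_zero_iff.2 hx)]⟩

open Classical in
/-- The extension of a function on the sphere to `ℝ³ ∖ {0}` which is constant on rays, that is,
in the directions normal to the sphere (with the irrelevant value `0` at the origin). -/
def radialExt {F : Type} [Zero F] (f : S2 → F) (x : E3) : F :=
  if hx : x ≠ 0 then f (radialProj x hx) else 0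

/-- The orthogonal projection of `ℝ³` onto the tangent plane `T_y 𝕊² = y^⊥`. -/
def tangentProj (y : S2) : E3 →L[ℝ] E3 := ((ℝ ∙ (y : E3))ᗮ).starProjection

/-- The Riemannian gradient `∇_{𝕊²} f (y) ∈ T_y 𝕊²`: the tangential part of the Euclidean gradient
of an extension of `f`. -/
def grad (f : S2 → ℝ) (y : S2) : E3 :=
  tangentProj y (gradient (radialExt f) (y : E3))

/-- The Riemannian divergence at `y` of a tangent vector field `X` on the sphere: the trace of the
covariant derivative `v ↦ (D_v X)^{tangential}` on `T_y 𝕊²`. (The trace is taken over `ℝ³`; the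
normal direction contributes `0` because the values are tangential.) -/
def divergence (X : S2 → E3) (y : S2) : ℝ :=
  LinearMap.trace ℝ E3
    ((tangentProj y).comp (fderiv ℝ (radialExt X) (y : E3))).toLinearMap

/-- The (nonnegative) Laplace-Beltrami operator `Δ_{𝕊²} f = - div (∇_{𝕊²} f)`. -/
def laplaceBeltrami (f : S2 → ℝ) (y : S2) : ℝ := - divergence (grad f) y

/-- `f` is twice differentiable at `y`, so that `- div (∇_{𝕊²} f)` is defined at `y`: `f` is
differentiable at all points of the sphere near `y`, and the gradient field of `f` is
differentiable at `y`. (A map on the sphere is differentiable at a point if and only if its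
extension that is constant on rays is.) -/
def TwiceDifferentiableAt (f : S2 → ℝ) (y : S2) : Prop :=
  (∀ᶠ z : S2 in 𝓝 y, DifferentiableAt ℝ (radialExt f) (z : E3)) ∧
    DifferentiableAt ℝ (radialExt (grad f)) (y : E3)

end SphereSampling

end

namespace SphereSampling

open scoped ENNReal RealInnerProductSpace Pointwise

/-! The operator is compared with the continuous average `gaussInt` of `f y - f x`, and that average
with the Laplacian.

Discretisation: for equal areas the factor `totalArea / n` is the area of a patch, so `Lhat` is a
quadrature sum for `gaussInt`. Bounding the Gaussian and `f y - f x` separately would give an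
integrand with Lipschitz constant of order `t^(-1/2)`, an error of order `d / t^(5/2)`, and hence
the exponent `2α/5`. But the Gaussian is steep only where `f y - f x` is small: the integrand is
`4K`-Lipschitz uniformly in `t` (`lipschitzWith_gaussWeight_mul_sub`). The error is then of order `d
/ t²`, which vanishes for all `β > -α/2` and so covers the stated range.

Continuous limit (`tendsto_gaussInt_sub`): expand `f` at `y` to second order through its extension
constant on rays. The gradient term integrates to zero by reflection symmetry, the quadratic term
tends to the trace of the second derivative on the tangent plane, and the remainder is negligible.
The moments needed reduce to integrals over an interval by Archimedes' theorem (`map_inner_area`).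
-/

/-! ### Spherical coordinates -/

lemma lintegral_comp_sqrt_add_sq (h : ℝ → ℝ≥0∞) (hh : Measurable h) :
    ∫⁻ p : ℝ × ℝ, h (√(p.1 ^ 2 + p.2 ^ 2)) =
      ENNReal.ofReal (2 * Real.pi) * ∫⁻ r in Set.Ioi (0 : ℝ), ENNReal.ofReal r * h r := by
  rw [← lintegral_comp_polarCoord_symm]
  have h1 : ∀ p ∈ polarCoord.target,
      ENNReal.ofReal p.1 • h (√((polarCoord.symm p).1 ^ 2 + (polarCoord.symm p).2 ^ 2)) =
        ENNReal.ofReal p.1 * h p.1 := by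
    rintro ⟨r, θ⟩ ⟨hr, -⟩
    have hr' : 0 < r := hr
    simp only [polarCoord_symm_apply, smul_eq_mul]
    rw [show (r * Real.cos θ) ^ 2 + (r * Real.sin θ) ^ 2 = r ^ 2 by
      linear_combination r ^ 2 * Real.sin_sq_add_cos_sq θ, Real.sqrt_sq hr'.le]
  rw [setLIntegral_congr_fun polarCoord.open_target.measurableSet h1, polarCoord_target,
    Measure.volume_eq_prod, setLIntegral_prod _ (by fun_prop)]
  simp only [lintegral_const, Measure.restrict_apply_univ, Real.volume_Ioo]
  rw [lintegral_mul_const _ (by fun_prop), mul_comm]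
  congr 2
  ring

lemma lintegral_halfPlane_polar (k : ℝ × ℝ → ℝ≥0∞) (hk : Measurable k) :
    ∫⁻ c : ℝ, ∫⁻ ρ in Set.Ioi (0 : ℝ), k (c, ρ) =
      ∫⁻ r in Set.Ioi (0 : ℝ), ∫⁻ θ in Set.Ioo 0 Real.pi,
        ENNReal.ofReal r * k (r * Real.cos θ, r * Real.sin θ) := by
  have hm : MeasurableSet (Set.univ ×ˢ Set.Ioi (0 : ℝ) : Set (ℝ × ℝ)) :=
    MeasurableSet.univ.prod measurableSet_Ioi
  have h0 : ∫⁻ c : ℝ, ∫⁻ ρ in Set.Ioi (0 : ℝ), k (c, ρ) =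
      ∫⁻ p : ℝ × ℝ, (Set.univ ×ˢ Set.Ioi (0 : ℝ)).indicator k p := by
    rw [lintegral_indicator hm, Measure.volume_eq_prod, setLIntegral_prod _ (by fun_prop)]
    simp
  rw [h0, ← lintegral_comp_polarCoord_symm, polarCoord_target, Measure.volume_eq_prod,
    setLIntegral_prod]
  · refine setLIntegral_congr_fun measurableSet_Ioi fun r hr => ?_
    have hr' : 0 < r := hr
    have hsub : Set.Ioo 0 Real.pi ⊆ Set.Ioo (-Real.pi) Real.pi :=
      Set.Ioo_subset_Ioo_left (by linarith [Real.pi_pos])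
    rw [← lintegral_indicator measurableSet_Ioo, ← lintegral_indicator measurableSet_Ioo]
    refine lintegral_congr fun θ => ?_
    by_cases hθ : θ ∈ Set.Ioo 0 Real.pi
    · rw [Set.indicator_of_mem (hsub hθ), Set.indicator_of_mem hθ, Set.indicator_of_mem]
      · simp
      · simpa using mul_pos hr' (Real.sin_pos_of_mem_Ioo hθ)
    · rw [Set.indicator_of_notMem hθ]
      by_cases hθ' : θ ∈ Set.Ioo (-Real.pi) Real.pi
      · rw [Set.indicator_of_mem hθ', Set.indicator_of_notMem]
        · simp
        · have : θ ≤ 0 := by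
            by_contra! h
            exact hθ ⟨h, hθ'.2⟩
          have := Real.sin_nonpos_of_nonpos_of_neg_pi_le this hθ'.1.le
          simp only [polarCoord_symm_apply, Set.mem_prod, Set.mem_univ, Set.mem_Ioi, true_and,
            not_lt]
          exact mul_nonpos_of_nonneg_of_nonpos hr'.le this
      · rw [Set.indicator_of_notMem hθ']
  · have : Measurable fun p : ℝ × ℝ => polarCoord.symm p := by
      simp only [polarCoord_symm_apply]; fun_prop
    refine Measurable.aemeasurable ?_
    refine (by fun_prop : Measurable fun p : ℝ × ℝ => ENNReal.ofReal p.1).smul ?_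
    exact (hk.indicator hm).comp this

/-- Two polar changes of variables: one in the plane orthogonal to the axis, one in the half-plane
of (height, distance to the axis). Their Jacobians are `r sin θ` and `r`. -/
lemma lintegral_cylindrical_eq_spherical (h : ℝ × ℝ → ℝ≥0∞) (hh : Measurable h) :
    ∫⁻ q : ℝ × (ℝ × ℝ), h (q.1, √(q.2.1 ^ 2 + q.2.2 ^ 2)) =
      ENNReal.ofReal (2 * Real.pi) * ∫⁻ r in Set.Ioi (0 : ℝ), ∫⁻ θ in Set.Ioo 0 Real.pi,
        ENNReal.ofReal r * (ENNReal.ofReal (r * Real.sin θ) *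
          h (r * Real.cos θ, r * Real.sin θ)) := by
  rw [Measure.volume_eq_prod, lintegral_prod _ (by fun_prop)]
  have h1 : ∀ c : ℝ, ∫⁻ p : ℝ × ℝ, h (c, √(p.1 ^ 2 + p.2 ^ 2)) =
      ENNReal.ofReal (2 * Real.pi) * ∫⁻ ρ in Set.Ioi (0 : ℝ), ENNReal.ofReal ρ * h (c, ρ) :=
    fun c => lintegral_comp_sqrt_add_sq (fun ρ => h (c, ρ)) (by fun_prop)
  simp only [h1]
  rw [lintegral_const_mul']
  · congr 1
    exact lintegral_halfPlane_polar (fun p => ENNReal.ofReal p.2 * h p) (by fun_prop)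
  · exact ENNReal.ofReal_ne_top

lemma setLIntegral_sin_mul_comp_cos (ψ : ℝ → ℝ≥0∞) :
    ∫⁻ θ in Set.Ioo 0 Real.pi, ENNReal.ofReal (Real.sin θ) * ψ (Real.cos θ) =
      ∫⁻ u in Set.Icc (-1) 1, ψ u := by
  have himg : Real.cos '' Set.Icc 0 Real.pi = Set.Icc (-1) 1 := Real.bijOn_cos.image_eq
  rw [← himg, lintegral_image_eq_lintegral_abs_deriv_mul measurableSet_Icc
    (fun θ _ => (Real.hasDerivAt_cos θ).hasDerivWithinAt) Real.injOn_cos,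
    setLIntegral_congr (Ioo_ae_eq_Icc (a := (0 : ℝ)) (b := Real.pi))]
  refine setLIntegral_congr_fun measurableSet_Icc fun θ hθ => ?_
  rw [abs_neg, abs_of_nonneg (Real.sin_nonneg_of_mem_Icc hθ)]

/-! ### The area measure through cones, and Archimedes' theorem -/

lemma Ioo_smul_image_coe (s : Set S2) :
    Set.Ioo (0 : ℝ) 1 • ((fun x : S2 => (x : E3)) '' s) =
      {z : E3 | ∃ hz : z ≠ 0, ‖z‖ < 1 ∧ radialProj z hz ∈ s} := by
  ext z
  constructor
  · rintro ⟨r, hr, _, ⟨x, hx, rfl⟩, rfl⟩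
    have hnx : ‖(x : E3)‖ = 1 := mem_sphere_zero_iff_norm.1 x.2
    have hn : ‖r • (x : E3)‖ = r := by rw [norm_smul, hnx, mul_one, Real.norm_of_nonneg hr.1.le]
    have hz : r • (x : E3) ≠ 0 := by
      rw [← norm_ne_zero_iff, hn]; exact hr.1.ne'
    refine ⟨hz, by simpa [hn] using hr.2, ?_⟩
    convert hx
    ext1
    simp only [radialProj, hn]
    rw [smul_smul, inv_mul_cancel₀ hr.1.ne', one_smul]
  · rintro ⟨hz, hz1, hs⟩
    refine ⟨‖z‖, ⟨norm_pos_iff.2 hz, hz1⟩, _, ⟨_, hs, rfl⟩, ?_⟩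
    simp only [radialProj]
    rw [smul_smul, mul_inv_cancel₀ (norm_ne_zero_iff.2 hz), one_smul]

lemma area_apply {s : Set S2} (hs : MeasurableSet s) :
    area s = 3 * volume {z : E3 | ∃ hz : z ≠ 0, ‖z‖ < 1 ∧ radialProj z hz ∈ s} := by
  rw [area, Measure.toSphere_apply' _ hs, ← Ioo_smul_image_coe]
  simp

/-- The map of the sphere induced by a linear isometry. -/
noncomputable def sphereMap (e : E3 ≃ₗᵢ[ℝ] E3) (x : S2) : S2 :=
  ⟨e x, by rw [mem_sphere_zero_iff_norm, e.norm_map]; exact mem_sphere_zero_iff_norm.1 x.2⟩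

/-- A linear isometry preserves volume and maps the cone over a preimage onto the cone over the set.
-/
lemma measurePreserving_sphereMap (e : E3 ≃ₗᵢ[ℝ] E3) :
    MeasurePreserving (sphereMap e) area area := by
  have hm : Measurable (sphereMap e) :=
    ((e.continuous.comp continuous_subtype_val).subtype_mk _).measurable
  refine ⟨hm, Measure.ext fun s hs => ?_⟩
  rw [Measure.map_apply hm hs, area_apply (hm hs), area_apply hs]
  congr 1
  have := e.measurePreserving.measure_preimage_emb e.toHomeomorph.measurableEmbedding
    {z : E3 | ∃ hz : z ≠ 0, ‖z‖ < 1 ∧ radialProj z hz ∈ s}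
  rw [← this]
  congr 1
  ext z
  simp only [Set.mem_preimage, Set.mem_ofPred_eq, e.norm_map]
  have hz0 : e z ≠ 0 ↔ z ≠ 0 := by simp
  have hp : ∀ (hz : z ≠ 0) (hz' : e z ≠ 0), sphereMap e (radialProj z hz) = radialProj (e z) hz' := by
    intro hz hz'
    ext1
    simp [sphereMap, radialProj]
  constructor
  · rintro ⟨hz, h1, h2⟩
    exact ⟨hz0.2 hz, h1, by rwa [← hp hz]⟩
  · rintro ⟨hz, h1, h2⟩
    exact ⟨hz0.1 hz, h1, by rwa [hp _ hz]⟩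

/-- The coordinates of a point of `ℝ³` in an orthonormal basis. -/
lemma measurePreserving_coordinates (b : OrthonormalBasis (Fin 3) ℝ E3) :
    MeasurePreserving (fun z : E3 => ((⟪b 0, z⟫, (⟪b 1, z⟫, ⟪b 2, z⟫)) : ℝ × (ℝ × ℝ))) := by
  have h := ((MeasurePreserving.id (volume : Measure ℝ)).prod
    (volume_preserving_finTwoArrow ℝ)).comp
    ((volume_preserving_piFinSuccAbove (fun _ : Fin 3 => ℝ) 0).comp
      ((PiLp.volume_preserving_ofLp (Fin 3)).comp b.measurePreserving_repr))
  have hfun : (fun z : E3 => ((⟪b 0, z⟫, (⟪b 1, z⟫, ⟪b 2, z⟫)) : ℝ × (ℝ × ℝ))) =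
      Prod.map id MeasurableEquiv.finTwoArrow ∘
        (MeasurableEquiv.piFinSuccAbove (fun _ : Fin 3 => ℝ) 0) ∘ WithLp.ofLp ∘ b.repr := by
    ext z <;> simp only [← b.repr_apply_apply] <;> rfl
  rw [hfun]
  exact h

lemma exists_orthonormalBasis_apply_zero (y : S2) :
    ∃ b : OrthonormalBasis (Fin 3) ℝ E3, b 0 = (y : E3) := by
  have h : Orthonormal ℝ (({0} : Set (Fin 3)).domRestrict fun _ : Fin 3 => (y : E3)) := by
    refine ⟨fun i => mem_sphere_zero_iff_norm.1 y.2, fun i j hij => (hij ?_).elim⟩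
    exact Subsingleton.elim i j
  obtain ⟨b, hb⟩ := h.exists_orthonormalBasis_extension_of_card_eq (by simp)
  exact ⟨b, hb 0 rfl⟩

lemma norm_sq_eq_sum_coordinates (b : OrthonormalBasis (Fin 3) ℝ E3) (z : E3) :
    ‖z‖ ^ 2 = ⟪b 0, z⟫ ^ 2 + ⟪b 1, z⟫ ^ 2 + ⟪b 2, z⟫ ^ 2 := by
  rw [← b.sum_sq_norm_inner_right z, Fin.sum_univ_three]
  simp

/-- Archimedes' theorem: the orthogonal projection of the area measure of the sphere to a diameter
is `2π` times the Lebesgue measure. -/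
theorem map_inner_area (y : S2) :
    area.map (fun x : S2 => ⟪(y : E3), (x : E3)⟫) =
      ENNReal.ofReal (2 * Real.pi) • volume.restrict (Set.Icc (-1 : ℝ) 1) := by
  have hm : Measurable fun x : S2 => ⟪(y : E3), (x : E3)⟫ := by
    apply Continuous.measurable; fun_prop
  obtain ⟨b, hb⟩ := exists_orthonormalBasis_apply_zero y
  refine Measure.ext fun B hB => ?_
  rw [Measure.map_apply hm hB, area_apply (hm hB)]
  -- The cone over the preimage of `B`, in the coordinates (height along `y`, distance to the axis).
  set T : Set (ℝ × ℝ) := {p | (0 < p.1 ^ 2 + p.2 ^ 2 ∧ p.1 ^ 2 + p.2 ^ 2 < 1) ∧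
    (√(p.1 ^ 2 + p.2 ^ 2))⁻¹ * p.1 ∈ B} with hT
  have hTm : MeasurableSet T := by
    have hq : Measurable fun p : ℝ × ℝ => p.1 ^ 2 + p.2 ^ 2 := by fun_prop
    refine ((measurableSet_lt measurable_const hq).inter
      (measurableSet_lt hq measurable_const)).inter ?_
    exact (by fun_prop : Measurable fun p : ℝ × ℝ => (√(p.1 ^ 2 + p.2 ^ 2))⁻¹ * p.1) hB
  have hgm : Measurable fun q : ℝ × (ℝ × ℝ) => (q.1, √(q.2.1 ^ 2 + q.2.2 ^ 2)) := by fun_prop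
  have hset : {z : E3 | ∃ hz : z ≠ 0, ‖z‖ < 1 ∧
      radialProj z hz ∈ (fun x : S2 => ⟪(y : E3), (x : E3)⟫) ⁻¹' B} =
      (fun z : E3 => ((⟪b 0, z⟫, (⟪b 1, z⟫, ⟪b 2, z⟫)) : ℝ × (ℝ × ℝ))) ⁻¹'
        ((fun q : ℝ × (ℝ × ℝ) => (q.1, √(q.2.1 ^ 2 + q.2.2 ^ 2))) ⁻¹' T) := by
    ext z
    have h1 := norm_sq_eq_sum_coordinates b z
    have h2 : ⟪b 0, z⟫ ^ 2 + √(⟪b 1, z⟫ ^ 2 + ⟪b 2, z⟫ ^ 2) ^ 2 = ‖z‖ ^ 2 := by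
      rw [Real.sq_sqrt (by positivity)]; linarith
    rw [hb] at h1 h2
    simp only [Set.mem_preimage, hT, Set.mem_ofPred_eq, hb, h2, Real.sqrt_sq (norm_nonneg z),
      radialProj, inner_smul_right]
    rw [sq_lt_one_iff₀ (norm_nonneg z)]
    constructor
    · rintro ⟨h3, h4, h5⟩
      exact ⟨⟨by have := norm_pos_iff.2 h3; positivity, h4⟩, h5⟩
    · rintro ⟨⟨h3, h4⟩, h5⟩
      exact ⟨by rintro rfl; simp at h3, h4, h5⟩
  rw [hset, (measurePreserving_coordinates b).measure_preimage (hgm hTm).nullMeasurableSet,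
    ← lintegral_indicator_one (hgm hTm)]
  have hind : ∀ q : ℝ × (ℝ × ℝ),
      ((fun q : ℝ × (ℝ × ℝ) => (q.1, √(q.2.1 ^ 2 + q.2.2 ^ 2))) ⁻¹' T).indicator
        (1 : ℝ × (ℝ × ℝ) → ℝ≥0∞) q =
        T.indicator 1 (q.1, √(q.2.1 ^ 2 + q.2.2 ^ 2)) := fun q => rfl
  simp only [hind]
  rw [lintegral_cylindrical_eq_spherical _ (measurable_one.indicator hTm)]
  -- In polar form membership in `T` separates into `r < 1` and `cos θ ∈ B`, and `cos` carries `sin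
  -- θ dθ` to Lebesgue measure on `[-1, 1]`.
  have hr : ∀ r ∈ Set.Ioi (0 : ℝ), ∫⁻ θ in Set.Ioo 0 Real.pi,
        ENNReal.ofReal r * (ENNReal.ofReal (r * Real.sin θ) *
          T.indicator 1 (r * Real.cos θ, r * Real.sin θ)) =
        (Set.Iio (1 : ℝ)).indicator (fun r => ENNReal.ofReal (r ^ 2)) r *
          volume (B ∩ Set.Icc (-1) 1) := by
    intro r hr
    have hr' : 0 < r := hr
    have hv : volume (B ∩ Set.Icc (-1) 1) =
        ∫⁻ u in Set.Icc (-1) 1, B.indicator (1 : ℝ → ℝ≥0∞) u := by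
      rw [lintegral_indicator_one hB, Measure.restrict_apply hB]
    rw [hv, ← setLIntegral_sin_mul_comp_cos, ← lintegral_const_mul']
    · refine setLIntegral_congr_fun measurableSet_Ioo fun θ hθ => ?_
      have hs := Real.sin_pos_of_mem_Ioo hθ
      have h2 : (r * Real.cos θ) ^ 2 + (r * Real.sin θ) ^ 2 = r ^ 2 := by
        linear_combination r ^ 2 * Real.sin_sq_add_cos_sq θ
      have hmem : (r * Real.cos θ, r * Real.sin θ) ∈ T ↔ r ∈ Set.Iio (1 : ℝ) ∧ Real.cos θ ∈ B := by
        simp only [hT, Set.mem_ofPred_eq, h2, Real.sqrt_sq hr'.le, Set.mem_Iio]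
        rw [sq_lt_one_iff₀ hr'.le, ← mul_assoc, inv_mul_cancel₀ hr'.ne', one_mul]
        simp [pow_pos hr' 2]
      have hsq : ENNReal.ofReal r * ENNReal.ofReal (r * Real.sin θ) =
          ENNReal.ofReal (r ^ 2) * ENNReal.ofReal (Real.sin θ) := by
        rw [← ENNReal.ofReal_mul hr'.le, ← ENNReal.ofReal_mul (sq_nonneg r)]
        congr 1; ring
      rw [← mul_assoc, hsq]
      by_cases h3 : r ∈ Set.Iio (1 : ℝ) <;> by_cases h4 : Real.cos θ ∈ B
      · rw [Set.indicator_of_mem h3, Set.indicator_of_mem h4, Set.indicator_of_mem (hmem.2 ⟨h3, h4⟩)]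
        simp
      all_goals
        have h5 : (r * Real.cos θ, r * Real.sin θ) ∉ T := fun h => by
          first | exact h4 (hmem.1 h).2 | exact h3 (hmem.1 h).1
        rw [Set.indicator_of_notMem h5]
        first | rw [Set.indicator_of_notMem h4] | rw [Set.indicator_of_notMem h3]
        simp
    · by_cases h3 : r ∈ Set.Iio (1 : ℝ) <;> simp [h3]
  rw [setLIntegral_congr_fun measurableSet_Ioi hr, lintegral_mul_const _ (by
    exact (by fun_prop : Measurable fun r : ℝ => ENNReal.ofReal (r ^ 2)).indicator
      measurableSet_Iio)]
  -- The radial factor `1/3` cancels the dimension `3` in `area_apply`.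
  have hrad : ∫⁻ r in Set.Ioi (0 : ℝ),
      (Set.Iio (1 : ℝ)).indicator (fun r => ENNReal.ofReal (r ^ 2)) r = 3⁻¹ := by
    rw [lintegral_indicator measurableSet_Iio, Measure.restrict_restrict measurableSet_Iio,
      Set.inter_comm, Set.Ioi_inter_Iio, setLIntegral_congr Ioo_ae_eq_Ioc,
      ← ofReal_integral_eq_lintegral_ofReal
        (intervalIntegral.intervalIntegrable_pow 2).1 (ae_of_all _ fun r => sq_nonneg r),
      ← intervalIntegral.integral_of_le zero_le_one]
    rw [integral_pow]
    norm_num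
    rw [ENNReal.ofReal_div_of_pos (by norm_num)]
    simp
  rw [hrad, Measure.smul_apply, Measure.restrict_apply hB, smul_eq_mul,
    show ∀ x y : ℝ≥0∞, 3 * (x * (3⁻¹ * y)) = (3 * 3⁻¹) * (x * y) from fun x y => by ring,
    ENNReal.mul_inv_cancel (by norm_num) (by norm_num), one_mul]

/-! ### The rescaled Gaussian integral -/

instance : IsFiniteMeasure area := inferInstanceAs (IsFiniteMeasure (volume : Measure E3).toSphere)

lemma norm_coe_eq_one (x : S2) : ‖(x : E3)‖ = 1 := mem_sphere_zero_iff_norm.1 x.2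

lemma norm_sub_sq_eq_inner (x y : S2) :
    ‖(x : E3) - y‖ ^ 2 = 2 * (1 - ⟪(y : E3), (x : E3)⟫) := by
  rw [@norm_sub_sq_real, norm_coe_eq_one, norm_coe_eq_one, real_inner_comm]; ring

lemma _root_.Continuous.integrable_area {φ : S2 → ℝ} (hφ : Continuous φ) : Integrable φ area :=
  hφ.integrable_of_hasCompactSupport (HasCompactSupport.of_compactSpace φ)

/-- The Gaussian weight `exp (-‖x - y‖² / (4t))`. -/
noncomputable def gaussWeight (t : ℝ) (y x : S2) : ℝ :=
  Real.exp (-(‖(x : E3) - (y : E3)‖ ^ 2 / (4 * t)))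

@[fun_prop]
lemma continuous_gaussWeight (t : ℝ) (y : S2) : Continuous (gaussWeight t y) := by
  unfold gaussWeight; fun_prop

lemma gaussWeight_pos (t : ℝ) (y x : S2) : 0 < gaussWeight t y x := Real.exp_pos _

/-- The rescaled Gaussian integral `(4πt²)⁻¹ ∫ exp (-‖x - y‖² / (4t)) φ(x) dx` over the sphere. -/
noncomputable def gaussInt (y : S2) (t : ℝ) (φ : S2 → ℝ) : ℝ :=
  (4 * Real.pi * t ^ 2)⁻¹ * ∫ x, gaussWeight t y x * φ x ∂area

lemma gaussInt_add (y : S2) (t : ℝ) {φ ψ : S2 → ℝ} (hφ : Continuous φ) (hψ : Continuous ψ) :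
    gaussInt y t (fun x => φ x + ψ x) = gaussInt y t φ + gaussInt y t ψ := by
  simp only [gaussInt, mul_add]
  rw [integral_add (Continuous.integrable_area (by fun_prop))
    (Continuous.integrable_area (by fun_prop)), mul_add]

lemma gaussInt_const_mul (y : S2) (t c : ℝ) (φ : S2 → ℝ) :
    gaussInt y t (fun x => c * φ x) = c * gaussInt y t φ := by
  simp only [gaussInt, mul_left_comm _ c, integral_const_mul]

lemma gaussInt_neg (y : S2) (t : ℝ) (φ : S2 → ℝ) :
    gaussInt y t (fun x => -φ x) = -gaussInt y t φ := by
  simp only [gaussInt, mul_neg, integral_neg]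

lemma gaussInt_sum (y : S2) (t : ℝ) {ι : Type*} (s : Finset ι) {φ : ι → S2 → ℝ}
    (hφ : ∀ i ∈ s, Continuous (φ i)) :
    gaussInt y t (fun x => ∑ i ∈ s, φ i x) = ∑ i ∈ s, gaussInt y t (φ i) := by
  simp only [gaussInt, Finset.mul_sum]
  rw [integral_finsetSum, Finset.mul_sum]
  intro i hi
  have := hφ i hi
  exact Continuous.integrable_area (by fun_prop)

lemma abs_gaussInt_le (y : S2) (t : ℝ) {φ ψ : S2 → ℝ} (hψ : Continuous ψ)
    (h : ∀ x, |φ x| ≤ ψ x) : |gaussInt y t φ| ≤ gaussInt y t ψ := by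
  have h0 : 0 ≤ (4 * Real.pi * t ^ 2)⁻¹ := by positivity
  rw [gaussInt, gaussInt, abs_mul, abs_of_nonneg h0]
  refine mul_le_mul_of_nonneg_left ?_ h0
  have hc : Continuous fun x => gaussWeight t y x * ψ x := by fun_prop
  rw [← Real.norm_eq_abs]
  refine norm_integral_le_of_norm_le hc.integrable_area (ae_of_all _ fun x => ?_)
  rw [Real.norm_eq_abs, abs_mul, abs_of_pos (gaussWeight_pos t y x)]
  exact mul_le_mul_of_nonneg_left (h x) (gaussWeight_pos t y x).le

/-- The weight depends only on the distance to `y`, which an isometry fixing `y` preserves. -/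
lemma gaussInt_comp_sphereMap {y : S2} {e : E3 ≃ₗᵢ[ℝ] E3} (he : e y = y) (t : ℝ) {φ : S2 → ℝ}
    (hφ : Continuous φ) : gaussInt y t (fun x => φ (sphereMap e x)) = gaussInt y t φ := by
  have hw : ∀ x, gaussWeight t y x = gaussWeight t y (sphereMap e x) := by
    intro x
    simp only [gaussWeight, sphereMap]
    rw [← e.norm_map ((x : E3) - y), map_sub, he]
  simp only [gaussInt]
  congr 1
  have hm := measurePreserving_sphereMap e
  have hc : Continuous fun x => gaussWeight t y x * φ x := by fun_prop
  conv_rhs => rw [← hm.map_eq]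
  rw [integral_map hm.measurable.aemeasurable hc.aestronglyMeasurable]
  simp only [← hw]

lemma gaussInt_eq_zero_of_odd {y : S2} {e : E3 ≃ₗᵢ[ℝ] E3} (he : e y = y) (t : ℝ) {φ : S2 → ℝ}
    (hφ : Continuous φ) (hodd : ∀ x, φ (sphereMap e x) = -φ x) : gaussInt y t φ = 0 := by
  have h := gaussInt_comp_sphereMap he t hφ
  simp only [hodd, gaussInt_neg] at h
  linarith

/-- The Gaussian integral of a zonal function is a one-dimensional integral. -/
lemma gaussInt_zonal (y : S2) (t : ℝ) {ψ : ℝ → ℝ} (hψ : Continuous ψ) :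
    gaussInt y t (fun x => ψ (‖(x : E3) - y‖ ^ 2)) =
      (2 * t ^ 2)⁻¹ * ∫ s in (0 : ℝ)..2, Real.exp (-(s / (2 * t))) * ψ (2 * s) := by
  have hm : Measurable fun x : S2 => ⟪(y : E3), (x : E3)⟫ := by
    apply Continuous.measurable; fun_prop
  have hc : Continuous fun u : ℝ =>
    Real.exp (-(2 * (1 - u) / (4 * t))) * ψ (2 * (1 - u)) := by fun_prop
  have h1 : ∫ x, gaussWeight t y x * ψ (‖(x : E3) - y‖ ^ 2) ∂area =
      ∫ u, Real.exp (-(2 * (1 - u) / (4 * t))) * ψ (2 * (1 - u))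
        ∂(area.map fun x : S2 => ⟪(y : E3), (x : E3)⟫) := by
    rw [integral_map hm.aemeasurable hc.aestronglyMeasurable]
    simp only [gaussWeight, norm_sub_sq_eq_inner]
  -- Substitution `s = 1 - u`: `s` is half the squared distance to `y`.
  have h2 : ∫ u in Set.Icc (-1 : ℝ) 1, Real.exp (-(2 * (1 - u) / (4 * t))) * ψ (2 * (1 - u)) =
      ∫ s in (0 : ℝ)..2, Real.exp (-(s / (2 * t))) * ψ (2 * s) := by
    rw [integral_Icc_eq_integral_Ioc, ← intervalIntegral.integral_of_le (by norm_num)]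
    have := intervalIntegral.integral_comp_sub_left (a := -1) (b := 1)
      (fun s => Real.exp (-(s / (2 * t))) * ψ (2 * s)) 1
    rw [show (1 : ℝ) - 1 = 0 by norm_num, show (1 : ℝ) - -1 = 2 by norm_num] at this
    rw [← this]
    congr 1
    ext u
    congr 3
    rw [show (4 : ℝ) * t = 2 * (2 * t) by ring, mul_div_mul_left _ _ two_ne_zero]
  rw [gaussInt, h1, map_inner_area, integral_smul_measure, h2,
    ENNReal.toReal_ofReal (by positivity), smul_eq_mul, ← mul_assoc]
  congr 1
  rw [show 4 * Real.pi * t ^ 2 = 2 * Real.pi * (2 * t ^ 2) by ring, mul_inv, mul_comm,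
    ← mul_assoc, mul_inv_cancel₀ (by positivity), one_mul]

/-! ### Radial moments -/

lemma integral_exp_neg_div_mul_self {a : ℝ} (ha : a ≠ 0) (c : ℝ) :
    ∫ s in (0 : ℝ)..c, Real.exp (-(s / a)) * s =
      a ^ 2 - (a * c + a ^ 2) * Real.exp (-(c / a)) := by
  rw [intervalIntegral.integral_eq_sub_of_hasDerivAt
    (f := fun s => -((a * s + a ^ 2) * Real.exp (-(s / a))))]
  · simp; ring
  · intro s _
    have h1 : HasDerivAt (fun s : ℝ => Real.exp (-(s / a))) (Real.exp (-(s / a)) * -(1 / a)) s :=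
      ((hasDerivAt_id s).div_const a).neg.exp
    have h2 : HasDerivAt (fun s : ℝ => a * s + a ^ 2) (a * 1) s :=
      ((hasDerivAt_id s).const_mul a).add_const _
    refine (h2.mul h1).neg.congr_deriv ?_
    field_simp
    ring
  · exact Continuous.intervalIntegrable (by fun_prop) _ _

lemma integral_exp_neg_div_mul_sq {a : ℝ} (ha : a ≠ 0) (c : ℝ) :
    ∫ s in (0 : ℝ)..c, Real.exp (-(s / a)) * s ^ 2 =
      2 * a ^ 3 - (a * c ^ 2 + 2 * a ^ 2 * c + 2 * a ^ 3) * Real.exp (-(c / a)) := by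
  rw [intervalIntegral.integral_eq_sub_of_hasDerivAt
    (f := fun s => -((a * s ^ 2 + 2 * a ^ 2 * s + 2 * a ^ 3) * Real.exp (-(s / a))))]
  · simp; ring
  · intro s _
    have h1 : HasDerivAt (fun s : ℝ => Real.exp (-(s / a))) (Real.exp (-(s / a)) * -(1 / a)) s :=
      ((hasDerivAt_id s).div_const a).neg.exp
    have h2 : HasDerivAt (fun s : ℝ => a * s ^ 2 + 2 * a ^ 2 * s + 2 * a ^ 3)
        (a * (2 * s) + 2 * a ^ 2 * 1) s := by
      have h3 : HasDerivAt (fun s : ℝ => s ^ 2) (2 * s) s := by simpa using hasDerivAt_pow 2 s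
      exact ((h3.const_mul a).add ((hasDerivAt_id s).const_mul _)).add_const _
    refine (h2.mul h1).neg.congr_deriv ?_
    field_simp
    ring
  · exact Continuous.intervalIntegrable (by fun_prop) _ _

lemma gaussInt_norm_sub_sq (y : S2) {t : ℝ} (ht : 0 < t) :
    gaussInt y t (fun x => ‖(x : E3) - y‖ ^ 2) = 4 - 4 * (t⁻¹ * Real.exp (-t⁻¹) + Real.exp (-t⁻¹)) := by
  rw [gaussInt_zonal y t (ψ := fun s => s) continuous_id]
  simp only [mul_left_comm _ (2 : ℝ), intervalIntegral.integral_const_mul]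
  rw [integral_exp_neg_div_mul_self (by positivity),
    show (2 : ℝ) / (2 * t) = t⁻¹ by field_simp]
  field_simp
  ring

lemma gaussInt_norm_sub_sq_le (y : S2) {t : ℝ} (ht : 0 < t) :
    gaussInt y t (fun x => ‖(x : E3) - y‖ ^ 2) ≤ 4 := by
  rw [gaussInt_norm_sub_sq y ht]
  have : 0 ≤ t⁻¹ * Real.exp (-t⁻¹) + Real.exp (-t⁻¹) := by positivity
  linarith

lemma gaussInt_norm_sub_pow_four_le (y : S2) {t : ℝ} (ht : 0 < t) :
    gaussInt y t (fun x => (‖(x : E3) - y‖ ^ 2) ^ 2) ≤ 32 * t := by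
  rw [gaussInt_zonal y t (ψ := fun s => s ^ 2) (by fun_prop)]
  simp only [mul_pow, mul_left_comm _ ((2 : ℝ) ^ 2), intervalIntegral.integral_const_mul]
  rw [integral_exp_neg_div_mul_sq (by positivity)]
  have h : 0 ≤ (2 * t * 2 ^ 2 + 2 * (2 * t) ^ 2 * 2 + 2 * (2 * t) ^ 3) *
    Real.exp (-(2 / (2 * t))) := by positivity
  calc _ ≤ 2 ^ 2 * ((2 * t ^ 2)⁻¹ * (2 * (2 * t) ^ 3)) :=
        mul_le_mul_of_nonneg_left (mul_le_mul_of_nonneg_left (by linarith only [h])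
          (by positivity)) (by positivity)
    _ = 32 * t := by field_simp; ring

lemma tendsto_gaussInt_norm_sub_sq (y : S2) :
    Tendsto (fun t => gaussInt y t (fun x => ‖(x : E3) - y‖ ^ 2)) (𝓝[>] 0) (𝓝 4) := by
  have h0 : Tendsto (fun t : ℝ => t⁻¹) (𝓝[>] 0) atTop := tendsto_inv_nhdsGT_zero
  have h1 : Tendsto (fun t : ℝ => t⁻¹ * Real.exp (-t⁻¹)) (𝓝[>] 0) (𝓝 0) := by
    have := (Real.tendsto_pow_mul_exp_neg_atTop_nhds_zero 1).comp h0
    simpa [Function.comp_def] using this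
  have h2 : Tendsto (fun t : ℝ => Real.exp (-t⁻¹)) (𝓝[>] 0) (𝓝 0) :=
    Real.tendsto_exp_neg_atTop_nhds_zero.comp h0
  have h3 : Tendsto (fun t : ℝ => 4 - 4 * (t⁻¹ * Real.exp (-t⁻¹) + Real.exp (-t⁻¹)))
      (𝓝[>] 0) (𝓝 4) := by
    simpa using ((h1.add h2).const_mul 4).const_sub 4
  refine h3.congr' ?_
  filter_upwards [self_mem_nhdsWithin] with t ht
  exact (gaussInt_norm_sub_sq y ht).symm

lemma tendsto_gaussInt_norm_sub_pow_four (y : S2) :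
    Tendsto (fun t => gaussInt y t (fun x => (‖(x : E3) - y‖ ^ 2) ^ 2)) (𝓝[>] 0) (𝓝 0) := by
  have h : Tendsto (fun t : ℝ => 32 * t) (𝓝[>] 0) (𝓝 0) := by
    have : Tendsto (fun t : ℝ => 32 * t) (𝓝 0) (𝓝 (32 * 0)) := tendsto_id.const_mul 32
    rw [mul_zero] at this
    exact this.mono_left nhdsWithin_le_nhds
  refine squeeze_zero' (Eventually.of_forall fun t => ?_) ?_ h
  · unfold gaussInt
    have := integral_nonneg (μ := area) (f := fun x : S2 =>
      gaussWeight t y x * (‖(x : E3) - y‖ ^ 2) ^ 2)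
      fun x => mul_nonneg (gaussWeight_pos t y x).le (by positivity)
    positivity
  · filter_upwards [self_mem_nhdsWithin] with t ht
    exact gaussInt_norm_sub_pow_four_le y ht

/-! ### Symmetry and the limit on quadratic forms -/

section Basis

variable {y : S2} {b : OrthonormalBasis (Fin 3) ℝ E3}

lemma inner_reflection_eq (K : Submodule ℝ E3) [K.HasOrthogonalProjection] (v z : E3) :
    ⟪v, K.reflection z⟫ = ⟪K.reflection v, z⟫ := by
  rw [← K.reflection.inner_map_map v, K.reflection_reflection]

lemma reflection_basis_self (b : OrthonormalBasis (Fin 3) ℝ E3) (i : Fin 3) :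
    (ℝ ∙ b i)ᗮ.reflection (b i) = -b i :=
  Submodule.reflection_orthogonalComplement_singleton_eq_neg _

lemma reflection_basis_of_ne (b : OrthonormalBasis (Fin 3) ℝ E3) {i j : Fin 3} (h : i ≠ j) :
    (ℝ ∙ b i)ᗮ.reflection (b j) = b j := by
  refine Submodule.reflection_mem_subspace_eq_self ?_
  rw [Submodule.mem_orthogonal_singleton_iff_inner_right]
  exact b.orthonormal.2 h

lemma gaussInt_inner_basis (hb : b 0 = (y : E3)) {i : Fin 3} (hi : i ≠ 0) (t : ℝ) :
    gaussInt y t (fun x => ⟪b i, (x : E3)⟫) = 0 := by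
  refine gaussInt_eq_zero_of_odd (e := (ℝ ∙ b i)ᗮ.reflection) ?_ t (by fun_prop) fun x => ?_
  · rw [← hb, reflection_basis_of_ne b hi]
  · simp only [sphereMap]
    rw [inner_reflection_eq, reflection_basis_self, inner_neg_left]

lemma gaussInt_inner_of_inner_eq_zero {w : E3} (hw : ⟪w, (y : E3)⟫ = 0) (t : ℝ) :
    gaussInt y t (fun x => ⟪w, (x : E3)⟫) = 0 := by
  obtain ⟨b, hb⟩ := exists_orthonormalBasis_apply_zero y
  have h : ∀ x : S2, ⟪w, (x : E3)⟫ = ∑ i, ⟪w, b i⟫ * ⟪b i, (x : E3)⟫ :=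
    fun x => (b.sum_inner_mul_inner w x).symm
  simp only [h]
  rw [gaussInt_sum _ _ _ fun i _ => by fun_prop]
  refine Finset.sum_eq_zero fun i _ => ?_
  rw [gaussInt_const_mul]
  by_cases hi : i = 0
  · rw [hi, hb, hw, zero_mul]
  · rw [gaussInt_inner_basis hb hi, mul_zero]

lemma gaussInt_inner_mul_inner_of_ne (hb : b 0 = (y : E3)) {i j : Fin 3} (hij : i ≠ j) (t : ℝ) :
    gaussInt y t (fun x => ⟪b i, (x : E3) - y⟫ * ⟪b j, (x : E3) - y⟫) = 0 := by
  -- At most one index is `0`; reflecting along a nonzero one fixes `y` and changes the sign of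
  -- exactly one factor.
  wlog hi : i ≠ 0 generalizing i j
  · have hj : j ≠ 0 := fun h => by simp_all
    simpa only [mul_comm] using this hij.symm hj
  have hR : (ℝ ∙ b i)ᗮ.reflection (y : E3) = y := by rw [← hb, reflection_basis_of_ne b hi]
  refine gaussInt_eq_zero_of_odd (e := (ℝ ∙ b i)ᗮ.reflection) hR t (by fun_prop) fun x => ?_
  have h : ∀ v : E3, ⟪v, (ℝ ∙ b i)ᗮ.reflection x - y⟫ = ⟪(ℝ ∙ b i)ᗮ.reflection v, (x : E3) - y⟫ := by
    intro v
    rw [← inner_reflection_eq, map_sub, hR]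
  simp only [sphereMap, h]
  rw [reflection_basis_self, reflection_basis_of_ne b hij, inner_neg_left, neg_mul]

/-- The reflection exchanging `b 1` and `b 2` fixes `y`. -/
lemma gaussInt_inner_sq_eq (hb : b 0 = (y : E3)) (t : ℝ) :
    gaussInt y t (fun x => ⟪b 1, (x : E3)⟫ ^ 2) = gaussInt y t (fun x => ⟪b 2, (x : E3)⟫ ^ 2) := by
  have hswap : (ℝ ∙ (b 1 - b 2))ᗮ.reflection (b 1) = b 2 :=
    Submodule.reflection_sub (by simp)
  have hR : (ℝ ∙ (b 1 - b 2))ᗮ.reflection (y : E3) = y := by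
    refine Submodule.reflection_mem_subspace_eq_self ?_
    rw [Submodule.mem_orthogonal_singleton_iff_inner_right, ← hb, inner_sub_left,
      b.orthonormal.2 (by decide), b.orthonormal.2 (by decide), sub_zero]
  rw [← gaussInt_comp_sphereMap hR t (φ := fun x => ⟪b 1, (x : E3)⟫ ^ 2) (by fun_prop)]
  simp only [sphereMap, inner_reflection_eq, hswap]

lemma tendsto_gaussInt_inner_sq (hb : b 0 = (y : E3)) {i : Fin 3} (hi : i ≠ 0) :
    Tendsto (fun t => gaussInt y t (fun x => ⟪b i, (x : E3) - y⟫ * ⟪b i, (x : E3) - y⟫))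
      (𝓝[>] 0) (𝓝 2) := by
  have h1 : ∀ x : S2, ⟪b i, (x : E3) - y⟫ * ⟪b i, (x : E3) - y⟫ = ⟪b i, (x : E3)⟫ ^ 2 := by
    intro x
    rw [inner_sub_right, ← hb, b.orthonormal.2 hi, sub_zero, sq]
  -- Each tangential moment is half of their sum, and that sum integrates `1 - ⟪y, x⟫² = q - q²/4`
  -- with `q = ‖x - y‖²`.
  have h2 : ∀ t, gaussInt y t (fun x => ⟪b 1, (x : E3)⟫ ^ 2) =
      (1 / 2) * (gaussInt y t (fun x => ‖(x : E3) - y‖ ^ 2) +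
        (-(1 / 4)) * gaussInt y t (fun x => (‖(x : E3) - y‖ ^ 2) ^ 2)) := by
    intro t
    have h3 : ∀ x : S2, ⟪b 1, (x : E3)⟫ ^ 2 + ⟪b 2, (x : E3)⟫ ^ 2 =
        ‖(x : E3) - y‖ ^ 2 + (-(1 / 4)) * (‖(x : E3) - y‖ ^ 2) ^ 2 := by
      intro x
      have h4 := norm_sq_eq_sum_coordinates b (x : E3)
      rw [norm_coe_eq_one, hb] at h4
      rw [norm_sub_sq_eq_inner]
      linarith
    rw [← gaussInt_const_mul, ← gaussInt_add _ _ (by fun_prop) (by fun_prop)]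
    simp only [← h3]
    rw [gaussInt_add _ _ (by fun_prop) (by fun_prop), ← gaussInt_inner_sq_eq hb]
    ring
  have h5 : Tendsto (fun t => gaussInt y t (fun x => ⟪b 1, (x : E3)⟫ ^ 2)) (𝓝[>] 0) (𝓝 2) := by
    simp only [h2]
    convert ((tendsto_gaussInt_norm_sub_sq y).add
      ((tendsto_gaussInt_norm_sub_pow_four y).const_mul (-(1 / 4)))).const_mul (1 / 2) using 2
    norm_num
  simp only [h1]
  fin_cases i
  · exact (hi rfl).elim
  · exact h5
  · exact h5.congr fun t => gaussInt_inner_sq_eq hb t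

/-- The normal component of `x - y` is `-‖x - y‖²/2`, so its square is of fourth order. -/
lemma tendsto_gaussInt_inner_zero_sq (hb : b 0 = (y : E3)) :
    Tendsto (fun t => gaussInt y t (fun x => ⟪b 0, (x : E3) - y⟫ * ⟪b 0, (x : E3) - y⟫))
      (𝓝[>] 0) (𝓝 0) := by
  have h1 : ∀ x : S2, ⟪b 0, (x : E3) - y⟫ * ⟪b 0, (x : E3) - y⟫ =
      (1 / 4) * (‖(x : E3) - y‖ ^ 2) ^ 2 := by
    intro x
    rw [inner_sub_right, hb, real_inner_self_eq_norm_sq, norm_coe_eq_one, norm_sub_sq_eq_inner]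
    ring
  simp only [h1, gaussInt_const_mul]
  have h2 := (tendsto_gaussInt_norm_sub_pow_four y).const_mul (1 / 4)
  rwa [mul_zero] at h2

/-- The rescaled Gaussian integral of a quadratic form centred at `y` converges to twice the trace
of the form on the tangent plane at `y`. -/
lemma tendsto_gaussInt_quadratic (hb : b 0 = (y : E3)) (A : E3 →L[ℝ] E3) :
    Tendsto (fun t => gaussInt y t (fun x => ⟪(x : E3) - y, A (x - y)⟫))
      (𝓝[>] 0) (𝓝 (2 * (⟪b 1, A (b 1)⟫ + ⟪b 2, A (b 2)⟫))) := by
  have h1 : ∀ v : E3, ⟪v, A v⟫ = ∑ i, ∑ j, ⟪b i, A (b j)⟫ * (⟪b i, v⟫ * ⟪b j, v⟫) := by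
    intro v
    conv_lhs => rw [← b.sum_inner_mul_inner v (A v)]
    refine Finset.sum_congr rfl fun i _ => ?_
    conv_lhs => rw [← b.sum_repr' v]
    rw [map_sum, inner_sum, Finset.mul_sum]
    refine Finset.sum_congr rfl fun j _ => ?_
    rw [b.sum_repr' v, map_smul, inner_smul_right, real_inner_comm]
    ring
  have h2 : ∀ t, gaussInt y t (fun x => ⟪(x : E3) - y, A (x - y)⟫) =
      ∑ i, ∑ j, ⟪b i, A (b j)⟫ *
        gaussInt y t (fun x => ⟪b i, (x : E3) - y⟫ * ⟪b j, (x : E3) - y⟫) := by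
    intro t
    simp only [h1]
    rw [gaussInt_sum _ _ _ fun i _ => by fun_prop]
    refine Finset.sum_congr rfl fun i _ => ?_
    rw [gaussInt_sum _ _ _ fun i _ => by fun_prop]
    exact Finset.sum_congr rfl fun j _ => gaussInt_const_mul _ _ _ _
  have h3 : ∀ i j : Fin 3, Tendsto (fun t => ⟪b i, A (b j)⟫ *
      gaussInt y t (fun x => ⟪b i, (x : E3) - y⟫ * ⟪b j, (x : E3) - y⟫)) (𝓝[>] 0)
      (𝓝 (⟪b i, A (b j)⟫ * if i = j then (if i = 0 then 0 else 2) else 0)) := by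
    intro i j
    refine Tendsto.const_mul _ ?_
    split_ifs with hij hi
    · subst hij hi
      exact tendsto_gaussInt_inner_zero_sq hb
    · subst hij
      exact tendsto_gaussInt_inner_sq hb hi
    · simp only [gaussInt_inner_mul_inner_of_ne hb hij]
      exact tendsto_const_nhds
  simp only [h2]
  convert tendsto_finsetSum Finset.univ fun i _ =>
    tendsto_finsetSum Finset.univ fun j _ => h3 i j using 2
  simp [Fin.sum_univ_three]
  ring

end Basis

/-- The rescaled Gaussian integral of a function that is `o(‖x - y‖²)` at `y` tends to `0`. -/
lemma tendsto_gaussInt_of_isLittleO {y : S2} {φ : S2 → ℝ} (hφ : Continuous φ)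
    (h : φ =o[𝓝 y] fun x => ‖(x : E3) - y‖ ^ 2) :
    Tendsto (fun t => gaussInt y t φ) (𝓝[>] 0) (𝓝 0) := by
  obtain ⟨M, hM⟩ := (isCompact_range hφ).isBounded.exists_norm_le
  have hM' : ∀ x, |φ x| ≤ M := fun x => hM _ ⟨x, rfl⟩
  have hM0 : 0 ≤ M := (abs_nonneg _).trans (hM' y)
  rw [Metric.tendsto_nhds]
  intro ε hε
  have h1 := h.def (show 0 < ε / 8 by positivity)
  obtain ⟨δ, hδ, hδ'⟩ := Metric.eventually_nhds_iff.1 h1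
  -- The quadratic term dominates near `y`; farther than `δ` the bound `M` is absorbed into a fourth
  -- power, whose integral is `O(t)`.
  have hbound : ∀ x : S2, |φ x| ≤ ε / 8 * ‖(x : E3) - y‖ ^ 2 +
      M / δ ^ 4 * (‖(x : E3) - y‖ ^ 2) ^ 2 := by
    intro x
    by_cases hx : dist x y < δ
    · have := hδ' hx
      rw [Real.norm_eq_abs, Real.norm_of_nonneg (by positivity)] at this
      have h2 : 0 ≤ M / δ ^ 4 * (‖(x : E3) - y‖ ^ 2) ^ 2 := by positivity
      linarith
    · rw [Subtype.dist_eq, dist_eq_norm] at hx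
      push Not at hx
      have h2 : δ ^ 4 ≤ (‖(x : E3) - y‖ ^ 2) ^ 2 := by
        rw [← pow_mul]; exact pow_le_pow_left₀ hδ.le hx 4
      have h3 : M ≤ M / δ ^ 4 * (‖(x : E3) - y‖ ^ 2) ^ 2 := by
        rw [div_mul_eq_mul_div, le_div_iff₀ (by positivity)]
        exact mul_le_mul_of_nonneg_left h2 hM0
      have h4 : 0 ≤ ε / 8 * ‖(x : E3) - y‖ ^ 2 := by positivity
      linarith [hM' x]
  have hlim : ∀ᶠ t in 𝓝[>] (0 : ℝ), M / δ ^ 4 * (32 * t) < ε / 4 := by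
    have : Tendsto (fun t : ℝ => M / δ ^ 4 * (32 * t)) (𝓝 0) (𝓝 (M / δ ^ 4 * (32 * 0))) :=
      (tendsto_id.const_mul 32).const_mul _
    rw [mul_zero, mul_zero] at this
    exact (this.mono_left nhdsWithin_le_nhds).eventually (gt_mem_nhds (by positivity))
  filter_upwards [self_mem_nhdsWithin, hlim] with t ht htε
  rw [Real.dist_eq, sub_zero]
  have h5 := abs_gaussInt_le y t (by fun_prop) hbound
  rw [gaussInt_add _ _ (by fun_prop) (by fun_prop), gaussInt_const_mul, gaussInt_const_mul] at h5
  have h6 : ε / 8 * gaussInt y t (fun x => ‖(x : E3) - y‖ ^ 2) ≤ ε / 8 * 4 :=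
    mul_le_mul_of_nonneg_left (gaussInt_norm_sub_sq_le y ht) (by positivity)
  have h7 : M / δ ^ 4 * gaussInt y t (fun x => (‖(x : E3) - y‖ ^ 2) ^ 2) ≤ M / δ ^ 4 * (32 * t) :=
    mul_le_mul_of_nonneg_left (gaussInt_norm_sub_pow_four_le y ht) (by positivity)
  linarith

/-! ### Lipschitz bound uniform in `t` -/

/-- If `2a ≤ b`, then `a ≤ b - a` and the exponentials differ by at most `1`. Otherwise `a + b ≤
3a`, and `u exp(-u) ≤ 1` at `u = a²/(4t)` removes the dependence on `t`. -/
lemma mul_exp_neg_sq_sub_le {t a b : ℝ} (ht : 0 < t) (ha : 0 ≤ a) (hab : a ≤ b) :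
    a * (Real.exp (-(a ^ 2 / (4 * t))) - Real.exp (-(b ^ 2 / (4 * t)))) ≤ 3 * (b - a) := by
  have hA1 : Real.exp (-(a ^ 2 / (4 * t))) ≤ 1 := Real.exp_le_one_iff.2 (by
    have : 0 ≤ a ^ 2 / (4 * t) := by positivity
    linarith)
  have hB0 := Real.exp_pos (-(b ^ 2 / (4 * t)))
  by_cases h2 : 2 * a ≤ b
  · have : a * (Real.exp (-(a ^ 2 / (4 * t))) - Real.exp (-(b ^ 2 / (4 * t)))) ≤ a * 1 :=
      mul_le_mul_of_nonneg_left (by linarith) ha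
    linarith
  · push Not at h2
    have hexp : Real.exp (-(a ^ 2 / (4 * t))) - Real.exp (-(b ^ 2 / (4 * t))) ≤
        Real.exp (-(a ^ 2 / (4 * t))) * (b ^ 2 / (4 * t) - a ^ 2 / (4 * t)) := by
      have h3 : Real.exp (-(b ^ 2 / (4 * t))) = Real.exp (-(a ^ 2 / (4 * t))) *
          Real.exp (-(b ^ 2 / (4 * t) - a ^ 2 / (4 * t))) := by
        rw [← Real.exp_add]; congr 1; ring
      have h4 := Real.add_one_le_exp (-(b ^ 2 / (4 * t) - a ^ 2 / (4 * t)))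
      have h5 := mul_le_mul_of_nonneg_left h4 (Real.exp_pos (-(a ^ 2 / (4 * t)))).le
      rw [h3]
      linarith
    have hmax : a ^ 2 / (4 * t) * Real.exp (-(a ^ 2 / (4 * t))) ≤ 1 := by
      have h6 := Real.add_one_le_exp (a ^ 2 / (4 * t))
      rw [Real.exp_neg, ← div_eq_mul_inv, div_le_one (Real.exp_pos _)]
      linarith
    calc a * (Real.exp (-(a ^ 2 / (4 * t))) - Real.exp (-(b ^ 2 / (4 * t))))
        ≤ a * (Real.exp (-(a ^ 2 / (4 * t))) * (b ^ 2 / (4 * t) - a ^ 2 / (4 * t))) :=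
          mul_le_mul_of_nonneg_left hexp ha
      _ = Real.exp (-(a ^ 2 / (4 * t))) * (b - a) / (4 * t) * (a * (b + a)) := by
          field_simp
          ring
      _ ≤ Real.exp (-(a ^ 2 / (4 * t))) * (b - a) / (4 * t) * (3 * a ^ 2) := by
          refine mul_le_mul_of_nonneg_left ?_ ?_
          · nlinarith
          · have : 0 ≤ b - a := by linarith
            positivity
      _ = 3 * (b - a) * (a ^ 2 / (4 * t) * Real.exp (-(a ^ 2 / (4 * t)))) := by
          field_simp
      _ ≤ 3 * (b - a) * 1 := mul_le_mul_of_nonneg_left hmax (by linarith)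
      _ = 3 * (b - a) := mul_one _

/-- The Lipschitz constant of the integrand of the extended graph Laplacian is bounded
uniformly in `t`. -/
lemma lipschitzWith_gaussWeight_mul_sub {f : S2 → ℝ} {K : ℝ≥0} (hf : LipschitzWith K f)
    {t : ℝ} (ht : 0 < t) (y : S2) :
    LipschitzWith (4 * K) fun x => gaussWeight t y x * (f y - f x) := by
  refine LipschitzWith.of_dist_le_mul fun x p => ?_
  -- With `p` the point nearer to `y`, the difference of weights multiplies `f y - f p`, which is at
  -- most `K ‖p - y‖`. This part costs `3K`, the variation of `f` costs `K`.
  wlog hxp : ‖(p : E3) - y‖ ≤ ‖(x : E3) - y‖ generalizing x p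
  · rw [dist_comm, dist_comm x p]
    exact this p x (le_of_not_ge hxp)
  have hK : (0 : ℝ) ≤ K := K.2
  have hdist : ‖(x : E3) - y‖ - ‖(p : E3) - y‖ ≤ dist x p := by
    rw [Subtype.dist_eq, dist_eq_norm]
    have := norm_sub_norm_le ((x : E3) - y) (p - y)
    rwa [sub_sub_sub_cancel_right] at this
  have hw1 : gaussWeight t y x ≤ 1 := Real.exp_le_one_iff.2 (by
    have : 0 ≤ ‖(x : E3) - y‖ ^ 2 / (4 * t) := by positivity
    linarith)
  have hmono : gaussWeight t y x ≤ gaussWeight t y p := by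
    unfold gaussWeight
    gcongr
  have h1 : |f p - f x| ≤ K * dist x p := by
    have := hf.dist_le_mul p x
    rwa [Real.dist_eq, dist_comm p x] at this
  have h2 : |f y - f p| ≤ K * ‖(p : E3) - y‖ := by
    have := hf.dist_le_mul y p
    rwa [Real.dist_eq, dist_comm y p, Subtype.dist_eq p y, dist_eq_norm] at this
  have h3 := mul_exp_neg_sq_sub_le ht (norm_nonneg ((p : E3) - y)) hxp
  change ‖(p : E3) - y‖ * (gaussWeight t y p - gaussWeight t y x) ≤ _ at h3
  rw [Real.dist_eq, show gaussWeight t y x * (f y - f x) - gaussWeight t y p * (f y - f p) =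
    gaussWeight t y x * (f p - f x) - (gaussWeight t y p - gaussWeight t y x) * (f y - f p) by ring]
  refine (abs_sub _ _).trans ?_
  rw [abs_mul, abs_mul, abs_of_pos (gaussWeight_pos t y x), abs_of_nonneg (sub_nonneg.2 hmono)]
  have h4 : gaussWeight t y x * |f p - f x| ≤ 1 * (K * dist x p) :=
    mul_le_mul hw1 h1 (abs_nonneg _) zero_le_one
  have h5 : (gaussWeight t y p - gaussWeight t y x) * |f y - f p| ≤ K * (3 * dist x p) := by
    calc _ ≤ (gaussWeight t y p - gaussWeight t y x) * (K * ‖(p : E3) - y‖) :=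
          mul_le_mul_of_nonneg_left h2 (sub_nonneg.2 hmono)
      _ = K * (‖(p : E3) - y‖ * (gaussWeight t y p - gaussWeight t y x)) := by ring
      _ ≤ K * (3 * dist x p) := mul_le_mul_of_nonneg_left (by linarith) hK
  push_cast
  linarith

/-! ### Quadrature error -/

namespace Sampling

variable {n : ℕ} (V : Sampling n)

lemma norm_sub_le_maxRadius {i : Fin n} {p : S2} (hp : p ∈ V.σ i) :
    ‖(V.x i : E3) - p‖ ≤ V.maxRadius := by
  have h1 : ‖(V.x i : E3) - p‖ ≤ V.d i := by
    -- The diameter `2` bounds the distances, so the real `sSup` is a true supremum.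
    refine le_csSup ⟨2, ?_⟩ ⟨p, hp, rfl⟩
    rintro _ ⟨q, -, rfl⟩
    refine (norm_sub_le _ _).trans ?_
    rw [norm_coe_eq_one, norm_coe_eq_one]
    norm_num
  exact h1.trans (le_ciSup (f := V.d) (Set.finite_range _).bddAbove i)

lemma integral_eq_sum_patch {g : S2 → ℝ} (hg : Integrable g area) :
    ∫ x, g x ∂area = ∑ i, ∫ x in V.σ i, g x ∂area := by
  rw [← tsum_fintype (L := .unconditional _), ← integral_iUnion_ae
    (fun i => (V.measurableSet_patch i).nullMeasurableSet)
    (fun i j hij => V.aedisjoint_patch i j hij) hg.integrableOn, ← setIntegral_univ]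
  refine setIntegral_congr_set ?_
  exact (ae_eq_univ.2 V.cover).symm

lemma sum_A : ∑ i, V.A i = totalArea := by
  have := V.integral_eq_sum_patch (integrable_const (1 : ℝ))
  simpa [A, totalArea] using this.symm

lemma A_eq_div (hV : V.IsEquiArea) (hn : n ≠ 0) (i : Fin n) : V.A i = totalArea / n := by
  have h : (n : ℝ) ≠ 0 := Nat.cast_ne_zero.2 hn
  rw [← V.sum_A, Finset.sum_congr rfl fun j _ => hV j i]
  simp only [Finset.sum_const, Finset.card_univ, Fintype.card_fin, nsmul_eq_mul]
  field_simp

/-- The quadrature error of a sampling for a Lipschitz function. -/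
lemma abs_sum_sub_integral_le {g : S2 → ℝ} {K : ℝ≥0} (hg : LipschitzWith K g) :
    |∑ i, V.A i * g (V.x i) - ∫ x, g x ∂area| ≤ K * V.maxRadius * totalArea := by
  have hint : Integrable g area := hg.continuous.integrable_area
  rw [V.integral_eq_sum_patch hint, ← Finset.sum_sub_distrib, ← V.sum_A, Finset.mul_sum]
  refine (Finset.abs_sum_le_sum_abs _ _).trans (Finset.sum_le_sum fun i _ => ?_)
  have h1 : V.A i * g (V.x i) - ∫ x in V.σ i, g x ∂area =
      ∫ x in V.σ i, (g (V.x i) - g x) ∂area := by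
    rw [integral_sub (integrable_const _) hint.integrableOn]
    simp [A]
  rw [h1, ← Real.norm_eq_abs]
  refine norm_setIntegral_le_of_norm_le_const (measure_lt_top _ _) fun p hp => ?_
  have h2 := hg.dist_le_mul (V.x i) p
  rw [Real.dist_eq, Subtype.dist_eq, dist_eq_norm] at h2
  exact h2.trans (mul_le_mul_of_nonneg_left (V.norm_sub_le_maxRadius hp) K.2)

/-- The rescaled extended graph Laplacian of an equi-area sampling approximates the rescaled
Gaussian integral. -/
lemma abs_Lhat_sub_gaussInt_le (hV : V.IsEquiArea) (hn : n ≠ 0) {f : S2 → ℝ} {K : ℝ≥0}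
    (hf : LipschitzWith K f) {t : ℝ} (ht : 0 < t) (y : S2) :
    |V.Lhat t f y - gaussInt y t (fun x => f y - f x)| ≤
      (4 * Real.pi * t ^ 2)⁻¹ * (4 * K * V.maxRadius * totalArea) := by
  have h1 : V.Lhat t f y = (4 * Real.pi * t ^ 2)⁻¹ *
      ∑ i, V.A i * (gaussWeight t y (V.x i) * (f y - f (V.x i))) := by
    simp only [Lhat, L, V.A_eq_div hV hn, ← Finset.mul_sum, gaussWeight]
    ring
  have h0 : 0 ≤ (4 * Real.pi * t ^ 2)⁻¹ := by positivity
  rw [h1, gaussInt, ← mul_sub, abs_mul, abs_of_nonneg h0]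
  refine mul_le_mul_of_nonneg_left ?_ h0
  simpa using V.abs_sum_sub_integral_le (lipschitzWith_gaussWeight_mul_sub hf ht y)

end Sampling

/-! ### Second-order expansion -/

/-- Taylor's formula of order two with Peano remainder, for a function that is twice
differentiable at a point. -/
lemma isLittleO_taylor_two {E : Type*} [NormedAddCommGroup E] [NormedSpace ℝ E] {F : E → ℝ}
    {F' : E → E →L[ℝ] ℝ} {F'' : E →L[ℝ] E →L[ℝ] ℝ} {y : E}
    (h1 : ∀ᶠ z in 𝓝 y, HasFDerivAt F (F' z) z) (h2 : HasFDerivAt F' F'' y) :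
    (fun z => F z - F y - F' y (z - y) - (1 / 2) * F'' (z - y) (z - y)) =o[𝓝 y]
      fun z => ‖z - y‖ ^ 2 := by
  refine Asymptotics.IsLittleO.of_bound fun ε hε => ?_
  obtain ⟨δ, hδ, hball⟩ := Metric.eventually_nhds_iff_ball.1 (h1.and (h2.isLittleO.def hε))
  filter_upwards [Metric.ball_mem_nhds y hδ] with z hz
  set v := z - y with hv
  have hmem : ∀ s ∈ Set.Icc (0 : ℝ) 1, y + s • v ∈ Metric.ball y δ := by
    intro s hs
    rw [Metric.mem_ball, dist_eq_norm] at hz ⊢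
    rw [add_sub_cancel_left, norm_smul, Real.norm_of_nonneg hs.1]
    exact (mul_le_of_le_one_left (norm_nonneg _) hs.2).trans_lt hz
  -- The mean value inequality is applied along the segment to `F` minus its Taylor terms; only `F''
  -- v v` enters, so symmetry of `F''` is not needed.
  have hder : ∀ s ∈ Set.Icc (0 : ℝ) 1, HasDerivWithinAt
      (fun s : ℝ => F (y + s • v) - s * F' y v - s ^ 2 * ((1 / 2) * F'' v v))
      (F' (y + s • v) v - 1 * F' y v - (2 * s) * ((1 / 2) * F'' v v)) (Set.Icc 0 1) s := by
    intro s hs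
    have h3 : HasDerivAt (fun s : ℝ => y + s • v) v s := by
      simpa using ((hasDerivAt_id s).smul_const v).const_add y
    have h4 : HasDerivAt (fun s : ℝ => F (y + s • v)) (F' (y + s • v) v) s :=
      (hball _ (hmem s hs)).1.comp_hasDerivAt s h3
    have h5 : HasDerivAt (fun s : ℝ => s ^ 2) (2 * s) s := by simpa using hasDerivAt_pow 2 s
    exact ((h4.sub ((hasDerivAt_id s).mul_const _)).sub (h5.mul_const _)).hasDerivWithinAt
  have hbd : ∀ s ∈ Set.Ico (0 : ℝ) 1,
      ‖F' (y + s • v) v - 1 * F' y v - (2 * s) * ((1 / 2) * F'' v v)‖ ≤ ε * ‖v‖ ^ 2 := by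
    intro s hs
    have h6 := (hball _ (hmem s ⟨hs.1, hs.2.le⟩)).2
    rw [add_sub_cancel_left] at h6
    have h7 : F' (y + s • v) v - 1 * F' y v - (2 * s) * ((1 / 2) * F'' v v) =
        (F' (y + s • v) - F' y - F'' (s • v)) v := by
      simp; ring
    rw [h7]
    calc _ ≤ ‖F' (y + s • v) - F' y - F'' (s • v)‖ * ‖v‖ := ContinuousLinearMap.le_opNorm _ _
      _ ≤ ε * ‖s • v‖ * ‖v‖ := by gcongr
      _ ≤ ε * ‖v‖ * ‖v‖ := by
          gcongr
          rw [norm_smul, Real.norm_of_nonneg hs.1]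
          exact mul_le_of_le_one_left (norm_nonneg _) hs.2.le
      _ = ε * ‖v‖ ^ 2 := by ring
  have h8 := norm_image_sub_le_of_norm_deriv_le_segment_01' hder hbd
  rw [Real.norm_of_nonneg (by positivity : (0 : ℝ) ≤ ‖v‖ ^ 2)]
  rw [one_smul, zero_smul, add_zero, show y + v = z by rw [hv]; abel] at h8
  rw [show F z - F y - F' y v - 1 / 2 * F'' v v =
    F z - 1 * F' y v - 1 ^ 2 * (1 / 2 * F'' v v) -
      (F y - 0 * F' y v - 0 ^ 2 * (1 / 2 * F'' v v)) by ring]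
  exact h8

/-! ### Calculus of the extension constant on rays -/

section RadialExt

variable {F : Type} [Zero F]

lemma radialExt_of_ne (g : S2 → F) {z : E3} (hz : z ≠ 0) : radialExt g z = g (radialProj z hz) :=
  dif_pos hz

lemma radialProj_coe (x : S2) (hx : (x : E3) ≠ 0) : radialProj x hx = x := by
  ext1
  simp [radialProj]

lemma coe_ne_zero (x : S2) : (x : E3) ≠ 0 := by
  rw [← norm_ne_zero_iff, norm_coe_eq_one]; exact one_ne_zero

lemma radialExt_coe (g : S2 → F) (x : S2) : radialExt g (x : E3) = g x := by
  rw [radialExt_of_ne g (coe_ne_zero x), radialProj_coe]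

lemma radialExt_smul (g : S2 → F) {c : ℝ} (hc : 0 < c) (z : E3) :
    radialExt g (c • z) = radialExt g z := by
  by_cases hz : z = 0
  · rw [hz, smul_zero]
  · rw [radialExt_of_ne g (smul_ne_zero hc.ne' hz), radialExt_of_ne g hz]
    congr 1
    ext1
    simp only [radialProj, norm_smul, Real.norm_of_nonneg hc.le]
    rw [smul_smul]
    congr 1
    field_simp

lemma eventually_nhds_radialProj {y : S2} {p : S2 → Prop} (h : ∀ᶠ x in 𝓝 y, p x) :
    ∀ᶠ z in 𝓝 (y : E3), ∃ hz : z ≠ 0, p (radialProj z hz) := by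
  rw [nhds_subtype_eq_comap, eventually_comap] at h
  have hc : ContinuousAt (fun z : E3 => ‖z‖⁻¹ • z) (y : E3) :=
    (continuousAt_id.norm.inv₀ (norm_ne_zero_iff.2 (coe_ne_zero y))).smul continuousAt_id
  have hc' : Tendsto (fun z : E3 => ‖z‖⁻¹ • z) (𝓝 (y : E3)) (𝓝 (y : E3)) := by
    simpa [ContinuousAt, norm_coe_eq_one] using hc
  filter_upwards [hc'.eventually h, isOpen_ne.mem_nhds (coe_ne_zero y)] with z hz hz0
  exact ⟨hz0, hz _ rfl⟩

end RadialExt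

lemma tangentProj_apply_of_inner_eq_zero {y : S2} {v : E3} (hv : ⟪(y : E3), v⟫ = 0) :
    tangentProj y v = v := by
  refine Submodule.starProjection_eq_self_iff.2 ?_
  rwa [Submodule.mem_orthogonal_singleton_iff_inner_right]

lemma tangentProj_self (y : S2) : tangentProj y (y : E3) = 0 :=
  Submodule.starProjection_orthogonalComplement_singleton_eq_zero _

lemma inner_tangentProj_left (y : S2) (v w : E3) :
    ⟪tangentProj y v, w⟫ = ⟪v, tangentProj y w⟫ :=
  Submodule.inner_starProjection_left_eq_right _ v w

lemma inner_grad_self (f : S2 → ℝ) (y : S2) : ⟪grad f y, (y : E3)⟫ = 0 := by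
  rw [grad, inner_tangentProj_left, tangentProj_self, inner_zero_right]

lemma inner_gradient_radialExt_self {f : S2 → ℝ} {x : S2}
    (hx : DifferentiableAt ℝ (radialExt f) (x : E3)) :
    ⟪gradient (radialExt f) (x : E3), (x : E3)⟫ = 0 := by
  have h1 : HasDerivAt (fun s : ℝ => s • (x : E3)) (x : E3) 1 := by
    simpa using (hasDerivAt_id (1 : ℝ)).smul_const (x : E3)
  have h2 : HasFDerivAt (radialExt f) (fderiv ℝ (radialExt f) (x : E3)) ((1 : ℝ) • (x : E3)) := by
    rw [one_smul]; exact hx.hasFDerivAt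
  have h3 := h2.comp_hasDerivAt 1 h1
  have h4 : HasDerivAt (radialExt f ∘ fun s : ℝ => s • (x : E3)) 0 1 := by
    refine (hasDerivAt_const (1 : ℝ) (radialExt f (x : E3))).congr_of_eventuallyEq ?_
    filter_upwards [lt_mem_nhds (zero_lt_one' ℝ)] with s hs
    exact radialExt_smul f hs _
  rw [gradient, InnerProductSpace.toDual_symm_apply]
  exact h3.unique h4

lemma grad_eq_gradient {f : S2 → ℝ} {x : S2}
    (hx : DifferentiableAt ℝ (radialExt f) (x : E3)) :
    grad f x = gradient (radialExt f) (x : E3) :=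
  tangentProj_apply_of_inner_eq_zero (by
    rw [real_inner_comm]; exact inner_gradient_radialExt_self hx)

/-- Invariance under scaling makes the derivative homogeneous of degree `-1`. Its expression through
`radialExt (grad f)` can be differentiated once more at `y`. -/
lemma hasFDerivAt_radialExt {f : S2 → ℝ} {z : E3} (hz : z ≠ 0)
    (h : DifferentiableAt ℝ (radialExt f) (radialProj z hz : E3)) :
    HasFDerivAt (radialExt f) (innerSL ℝ (‖z‖⁻¹ • radialExt (grad f) z)) z := by
  have hn : 0 < ‖z‖⁻¹ := inv_pos.2 (norm_pos_iff.2 hz)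
  have h1 : HasFDerivAt (fun w : E3 => ‖z‖⁻¹ • w) (‖z‖⁻¹ • ContinuousLinearMap.id ℝ E3) z :=
    ((ContinuousLinearMap.id ℝ E3).hasFDerivAt (x := z)).const_smul ‖z‖⁻¹
  have h2 : HasFDerivAt (radialExt f) (innerSL ℝ (radialExt (grad f) z)) (‖z‖⁻¹ • z) := by
    have h3 := h.hasGradientAt.hasFDerivAt
    rw [← grad_eq_gradient h] at h3
    rw [radialExt_of_ne (grad f) hz]
    exact h3
  have h4 := h2.comp z h1
  have h5 : (radialExt f ∘ fun w : E3 => ‖z‖⁻¹ • w) = radialExt f :=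
    funext fun w => radialExt_smul f hn w
  rw [h5] at h4
  refine h4.congr_fderiv ?_
  ext v
  simp

lemma hasFDerivAt_inv_norm (y : S2) :
    HasFDerivAt (fun z : E3 => ‖z‖⁻¹) (-innerSL ℝ (y : E3)) (y : E3) := by
  have h1 : HasFDerivAt (fun z : E3 => ‖z‖ ^ 2) (2 • innerSL ℝ (y : E3)) (y : E3) :=
    (hasStrictFDerivAt_norm_sq (y : E3)).hasFDerivAt
  have hy : ‖(y : E3)‖ ^ 2 = 1 := by rw [norm_coe_eq_one, one_pow]
  have h2 : HasDerivAt (fun s : ℝ => (√s)⁻¹) (-(1 / 2)) (‖(y : E3)‖ ^ 2) := by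
    rw [hy]
    refine ((Real.hasDerivAt_sqrt (one_ne_zero (α := ℝ))).inv (by simp)).congr_deriv ?_
    simp
  have h3 := h2.comp_hasFDerivAt (y : E3) h1
  have h4 : ((fun s : ℝ => (√s)⁻¹) ∘ fun z : E3 => ‖z‖ ^ 2) = fun z : E3 => ‖z‖⁻¹ := by
    ext z
    simp
  rw [h4] at h3
  refine h3.congr_fderiv ?_
  ext v
  simp

/-- The second-order expansion, in the ambient space, of a function on the sphere that is twice
differentiable at `y`, together with its Laplace-Beltrami operator. -/
lemma TwiceDifferentiableAt.exists_expansion {f : S2 → ℝ} {y : S2}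
    (hy : TwiceDifferentiableAt f y) {b : OrthonormalBasis (Fin 3) ℝ E3} (hb : b 0 = (y : E3)) :
    ∃ A : E3 →L[ℝ] E3,
      ((fun x : S2 => f x - f y - ⟪grad f y, (x : E3)⟫ -
        (1 / 2) * ⟪(x : E3) - y, A (x - y)⟫) =o[𝓝 y] fun x => ‖(x : E3) - y‖ ^ 2) ∧
      laplaceBeltrami f y = -(⟪b 1, A (b 1)⟫ + ⟪b 2, A (b 2)⟫) := by
  obtain ⟨h1, h2⟩ := hy
  set T := fderiv ℝ (radialExt (grad f)) (y : E3) with hT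
  have hG : radialExt (grad f) (y : E3) = grad f y := radialExt_coe _ y
  -- Product rule for `‖z‖⁻¹ • radialExt (grad f) z`; the rank-one term vanishes on the tangent
  -- plane, so it does not affect the tangential trace.
  set A : E3 →L[ℝ] E3 := ‖(y : E3)‖⁻¹ • T + (-innerSL ℝ (y : E3)).smulRight (grad f y) with hA
  have hH : HasFDerivAt (fun z : E3 => ‖z‖⁻¹ • radialExt (grad f) z) A (y : E3) := by
    have := (hasFDerivAt_inv_norm y).smul h2.hasFDerivAt
    rwa [hG] at this
  have hAv : ∀ v, A v = T v - ⟪(y : E3), v⟫ • grad f y := by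
    intro v
    simp [hA, sub_eq_add_neg]
  refine ⟨A, ?_, ?_⟩
  · have hF : ∀ᶠ z in 𝓝 (y : E3),
        HasFDerivAt (radialExt f) (innerSL ℝ (‖z‖⁻¹ • radialExt (grad f) z)) z := by
      filter_upwards [eventually_nhds_radialProj h1] with z ⟨hz, hz'⟩
      exact hasFDerivAt_radialExt hz hz'
    have hF' := (innerSL ℝ (E := E3)).hasFDerivAt.comp (y : E3) hH
    have hO := isLittleO_taylor_two hF hF'
    have hO' := hO.comp_tendsto (continuous_subtype_val.tendsto y)
    refine hO'.congr' ?_ ?_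
    · refine Eventually.of_forall fun x => ?_
      simp only [Function.comp_apply, radialExt_coe, norm_coe_eq_one, inv_one, one_smul,
        innerSL_apply_apply, inner_sub_right, inner_grad_self, sub_zero,
        ContinuousLinearMap.comp_apply]
      rw [real_inner_comm (A (x - y)) ((x : E3) - y)]
      rfl
    · exact Eventually.of_forall fun x => rfl
  · rw [laplaceBeltrami, divergence, LinearMap.trace_eq_sum_inner _ b, Fin.sum_univ_three]
    have h3 : ∀ i, ⟪b i, ((tangentProj y).comp T).toLinearMap (b i)⟫ =
        ⟪tangentProj y (b i), T (b i)⟫ := fun i => (inner_tangentProj_left y _ _).symm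
    have h4 : ∀ i, i ≠ 0 → ⟪b i, ((tangentProj y).comp T).toLinearMap (b i)⟫ = ⟪b i, A (b i)⟫ := by
      intro i hi
      have h5 : ⟪(y : E3), b i⟫ = 0 := by rw [← hb]; exact b.orthonormal.2 hi.symm
      rw [h3, tangentProj_apply_of_inner_eq_zero h5, hAv, h5, zero_smul, sub_zero]
    rw [h3 0, hb, tangentProj_self, inner_zero_left, h4 1 (by decide), h4 2 (by decide), zero_add]

/-! ### Convergence to the Laplace-Beltrami operator -/

/-- The rescaled Gaussian integrals of `f y - f` converge to the Laplace-Beltrami operator. -/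
theorem tendsto_gaussInt_sub {f : S2 → ℝ} (hf : Continuous f) {y : S2}
    (hy : TwiceDifferentiableAt f y) :
    Tendsto (fun t => gaussInt y t (fun x => f y - f x)) (𝓝[>] 0) (𝓝 (laplaceBeltrami f y)) := by
  obtain ⟨b, hb⟩ := exists_orthonormalBasis_apply_zero y
  obtain ⟨A, hO, hΔ⟩ := hy.exists_expansion hb
  set R : S2 → ℝ := fun x => f x - f y - ⟪grad f y, (x : E3)⟫ -
        (1 / 2) * ⟪(x : E3) - y, A (x - y)⟫ with hR
  have hRc : Continuous R := by fun_prop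
  have h1 : ∀ t, gaussInt y t (fun x => f y - f x) =
      -(gaussInt y t R + (1 / 2) * gaussInt y t (fun x => ⟪(x : E3) - y, A (x - y)⟫)) := by
    intro t
    have h2 : ∀ x, f y - f x =
        -(R x + (1 / 2) * ⟪(x : E3) - y, A (x - y)⟫ + ⟪grad f y, (x : E3)⟫) := by
      intro x; simp only [hR]; ring
    simp only [h2]
    rw [gaussInt_neg, gaussInt_add _ _ (by fun_prop) (by fun_prop),
      gaussInt_add _ _ (by fun_prop) (by fun_prop), gaussInt_const_mul,
      gaussInt_inner_of_inner_eq_zero (inner_grad_self f y), add_zero]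
  simp only [h1]
  have h3 := ((tendsto_gaussInt_of_isLittleO hRc hO).add
    ((tendsto_gaussInt_quadratic hb A).const_mul (1 / 2))).neg
  convert h3 using 2
  rw [hΔ]; ring

lemma Sampling.size_ne_zero {n : ℕ} (V : Sampling n) : n ≠ 0 := by
  rintro rfl
  have h := V.cover
  rw [Set.iUnion_of_empty, Set.compl_empty] at h
  exact Measure.toSphere_ne_zero (volume : Measure E3) (Measure.measure_univ_eq_zero.1 h)

/-- Convergence of the rescaled extended graph Laplacians when `t = n ^ β` with `-α / 2 < β < 0`. -/
theorem tendsto_Lhat {N : ℕ → ℕ} (hN : Tendsto N atTop atTop) (V : ∀ k, Sampling (N k))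
    (hequi : ∀ k, (V k).IsEquiArea) {C α β : ℝ} (hβ : -(α / 2) < β) (hβ' : β < 0)
    (hd : ∀ k, (V k).maxRadius ≤ C / (N k : ℝ) ^ α) {f : S2 → ℝ} {K : ℝ≥0}
    (hf : LipschitzWith K f) {y : S2} (hy : TwiceDifferentiableAt f y) :
    Tendsto (fun k => (V k).Lhat ((N k : ℝ) ^ β) f y) atTop (𝓝 (laplaceBeltrami f y)) := by
  have hN' : Tendsto (fun k => (N k : ℝ)) atTop atTop := tendsto_natCast_atTop_atTop.comp hN
  have hpos : ∀ k, 0 < (N k : ℝ) := fun k => Nat.cast_pos.2 (Nat.pos_of_ne_zero (V k).size_ne_zero)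
  have ht : Tendsto (fun k => (N k : ℝ) ^ β) atTop (𝓝[>] 0) := by
    refine tendsto_nhdsWithin_iff.2
      ⟨?_, Eventually.of_forall fun k => Real.rpow_pos_of_pos (hpos k) β⟩
    simpa [Function.comp_def] using (tendsto_rpow_neg_atTop (neg_pos.2 hβ')).comp hN'
  have hmain := (tendsto_gaussInt_sub hf.continuous hy).comp ht
  have herr : Tendsto (fun k => (V k).Lhat ((N k : ℝ) ^ β) f y -
      gaussInt y ((N k : ℝ) ^ β) (fun x => f y - f x)) atTop (𝓝 0) := by
    have hlim : Tendsto (fun k => (4 * Real.pi)⁻¹ * (4 * K * C * totalArea) *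
        (N k : ℝ) ^ (-(α + 2 * β))) atTop (𝓝 0) := by
      have := ((tendsto_rpow_neg_atTop (by linarith : 0 < α + 2 * β)).comp hN').const_mul
        ((4 * Real.pi)⁻¹ * (4 * K * C * totalArea))
      rwa [mul_zero] at this
    refine squeeze_zero_norm (fun k => ?_) hlim
    have hA : 0 ≤ totalArea := measureReal_nonneg
    refine ((V k).abs_Lhat_sub_gaussInt_le (hequi k) (V k).size_ne_zero hf
      (Real.rpow_pos_of_pos (hpos k) β) y).trans ?_
    calc (4 * Real.pi * ((N k : ℝ) ^ β) ^ 2)⁻¹ * (4 * K * (V k).maxRadius * totalArea)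
        ≤ (4 * Real.pi * ((N k : ℝ) ^ β) ^ 2)⁻¹ * (4 * K * (C / (N k : ℝ) ^ α) * totalArea) := by
          have := hd k
          gcongr
      _ = (4 * Real.pi)⁻¹ * (4 * K * C * totalArea) * (N k : ℝ) ^ (-(α + 2 * β)) := by
          rw [Real.rpow_neg (hpos k).le, Real.rpow_add (hpos k), two_mul,
            Real.rpow_add (hpos k)]
          have h1 := (Real.rpow_pos_of_pos (hpos k) α).ne'
          have h2 := (Real.rpow_pos_of_pos (hpos k) β).ne'
          field_simp
  simpa [Function.comp_def] using herr.add hmain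

end SphereSampling

theorem theorem1
    (N : ℕ → ℕ) (hN : Tendsto N atTop atTop)
    (V : ∀ k : ℕ, SphereSampling.Sampling (N k))
    (hequi : ∀ k : ℕ, (V k).IsEquiArea)
    (C α : ℝ) (hα : 0 < α) (hα' : α ≤ 1 / 2)
    (hd : ∀ k : ℕ, (V k).maxRadius ≤ C / (N k : ℝ) ^ α)
    (f : SphereSampling.S2 → ℝ) (hf : ∃ K : ℝ≥0, LipschitzWith K f)
    (y : SphereSampling.S2) (hy : SphereSampling.TwiceDifferentiableAt f y) :
    (∃ β : ℝ, Tendsto (fun k : ℕ => (V k).Lhat ((N k : ℝ) ^ β) f y) atTop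
        (𝓝 (SphereSampling.laplaceBeltrami f y))) ∧
      ∀ β : ℝ, -(2 * α / 5) < β → β < 0 →
        Tendsto (fun k : ℕ => (V k).Lhat ((N k : ℝ) ^ β) f y) atTop
          (𝓝 (SphereSampling.laplaceBeltrami f y)) := by
  obtain ⟨K, hK⟩ := hf
  have h : ∀ β : ℝ, -(2 * α / 5) < β → β < 0 →
      Tendsto (fun k : ℕ => (V k).Lhat ((N k : ℝ) ^ β) f y) atTop
        (𝓝 (SphereSampling.laplaceBeltrami f y)) := fun β h1 h2 =>
    SphereSampling.tendsto_Lhat hN V hequi (by linarith) h2 hd hK hy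
  -- The midpoint of the admissible interval.
  exact ⟨⟨-(α / 5), h _ (by linarith) (by linarith)⟩, h⟩
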